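/- Let $(X,d)$ be a compact metric space with a base point $e\in X$. Let $\mathrm{Lip}_0(X)$ be the Banach space of all Lipschitz functions $f\colon X\to\mathbb{R}$ with $f(e)=0$, normed by the least Lipschitz constant $L(f)$ of $f$. For $x\in X$ let $j(x)\in\mathrm{Lip}_0(X)^*$ be the evaluation functional $f\mapsto f(x)$, and let the Lipschitz-free space $\mathcal{F}(X)=\overline{\mathrm{span}}\,j(X)\subset\mathrm{Lip}_0(X)^*$ carry the dual norm. For distinct $p,q\in X$ put $$u_{pq}=\frac{j(p)-j(q)}{\|j(p)-j(q)\|}\in\mathcal{F}(X).$$ The space $X$ is called concave if, for all distinct $p,q\in X$, the element $u_{pq}$ is a preserved extreme point of the closed unit ball $B_{\mathcal{F}(X)}$, that is, $u_{pq}$ is an extreme point of $B_{\mathcal{F}(X)}$ and its canonical image in the bidual $\mathcal{F}(X)^{**}$ is an extreme point of $B_{\mathcal{F}(X)^{**}}$. Three distinct points of $X$ are called metrically aligned if one of them, say $r$, lies strictly between the other two, $p$ and $q$, that is, $d(p,r)+d(r,q)=d(p,q)$. Then $X$ is concave if and only if no three distinct points of $X$ are metrically aligned. -/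

import Mathlib

namespace LipFree

noncomputable section

section Alignment

variable {X : Type*} [MetricSpace X]

/-- `r` lies between `p` and `q`. -/
def LiesBetween (r p q : X) : Prop :=
  dist p r + dist r q = dist p q

/-- `r` lies strictly between `p` and `q`: it lies between them and is neither of them. -/
def LiesStrictlyBetween (r p q : X) : Prop :=
  LiesBetween r p q ∧ r ≠ p ∧ r ≠ q

/-- Three distinct points are metrically aligned if one of them lies strictly between the
other two. -/
def MetricallyAligned (p q r : X) : Prop :=
  (p ≠ q ∧ q ≠ r ∧ p ≠ r) ∧
    (LiesStrictlyBetween p q r ∨ LiesStrictlyBetween q p r ∨ LiesStrictlyBetween r p q)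

end Alignment

section PreservedExtreme

/-- A preserved extreme point of the closed unit ball of a real normed space `Y`: an extreme
point of the closed unit ball of `Y` whose canonical image in the bidual is an extreme point of
the closed unit ball of the bidual. -/
def IsPreservedExtremePoint {Y : Type*} [NormedAddCommGroup Y] [NormedSpace ℝ Y] (y : Y) : Prop :=
  y ∈ Set.extremePoints ℝ (Metric.closedBall (0 : Y) 1) ∧
    NormedSpace.inclusionInDoubleDual ℝ Y y ∈
      Set.extremePoints ℝ (Metric.closedBall (0 : StrongDual ℝ (StrongDual ℝ Y)) 1)

end PreservedExtreme

section Lip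

variable {X : Type*} [MetricSpace X]

/-- The vector space of real Lipschitz functions on `X` that vanish at the base point `e`. -/
def lip0Submodule (e : X) : Submodule ℝ (X → ℝ) where
  carrier := {f | (∃ K : NNReal, LipschitzWith K f) ∧ f e = 0}
  zero_mem' := ⟨⟨0, LipschitzWith.const 0⟩, rfl⟩
  add_mem' := by
    rintro f g ⟨⟨K, hK⟩, hf⟩ ⟨⟨M, hM⟩, hg⟩
    exact ⟨⟨K + M, hK.add hM⟩, by simp [hf, hg]⟩
  smul_mem' := by
    rintro c f ⟨⟨K, hK⟩, hf⟩
    refine ⟨⟨‖c‖₊ * K, LipschitzWith.of_dist_le_mul fun x y => ?_⟩, by simp [hf]⟩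
    have h := hK.dist_le_mul x y
    simp only [Real.dist_eq, Pi.smul_apply, smul_eq_mul, NNReal.coe_mul, coe_nnnorm,
      Real.norm_eq_abs] at h ⊢
    rw [← mul_sub, abs_mul, mul_assoc]
    exact mul_le_mul_of_nonneg_left h (abs_nonneg c)

/-- The space `Lip₀(X)` as a type of its own, so that it carries the Lipschitz norm and not the
topology of pointwise convergence. -/
def Lip0 (e : X) : Type _ := lip0Submodule e

instance (e : X) : AddCommGroup (Lip0 e) := inferInstanceAs (AddCommGroup (lip0Submodule e))

instance (e : X) : Module ℝ (Lip0 e) := inferInstanceAs (Module ℝ (lip0Submodule e))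

instance (e : X) : CoeFun (Lip0 e) (fun _ => X → ℝ) := ⟨fun f => f.1⟩

theorem lip0_ext {e : X} {f g : Lip0 e} (h : ∀ x, f x = g x) : f = g :=
  Subtype.ext (funext h)

theorem lip0_add_apply {e : X} (f g : Lip0 e) (x : X) : (f + g) x = f x + g x := rfl

theorem lip0_smul_apply {e : X} (c : ℝ) (f : Lip0 e) (x : X) : (c • f) x = c * f x := rfl

theorem lip0_zero_apply {e : X} (x : X) : (0 : Lip0 e) x = 0 := rfl

theorem lip0_base {e : X} (f : Lip0 e) : f e = 0 := f.2.2

/-- The nonnegative real Lipschitz constants of a function. -/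
def lipBounds (f : X → ℝ) : Set ℝ :=
  {K | 0 ≤ K ∧ ∀ x y, |f x - f y| ≤ K * dist x y}

/-- The norm `L(f)`: the least Lipschitz constant of `f`. -/
instance (e : X) : Norm (Lip0 e) := ⟨fun f => sInf (lipBounds (f : X → ℝ))⟩

theorem lip0_norm_def {e : X} (f : Lip0 e) : ‖f‖ = sInf (lipBounds (f : X → ℝ)) := rfl

theorem lipBounds_bddBelow (f : X → ℝ) : BddBelow (lipBounds f) := ⟨0, fun _ h => h.1⟩

theorem lipBounds_nonempty {e : X} (f : Lip0 e) : (lipBounds (f : X → ℝ)).Nonempty := by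
  obtain ⟨K, hK⟩ := f.2.1
  refine ⟨K, K.2, fun x y => ?_⟩
  have h := hK.dist_le_mul x y
  rwa [Real.dist_eq] at h

theorem lip0_norm_nonneg {e : X} (f : Lip0 e) : 0 ≤ ‖f‖ :=
  Real.sInf_nonneg fun _ h => h.1

theorem lip0_norm_le {e : X} (f : Lip0 e) {K : ℝ} (hK : 0 ≤ K)
    (h : ∀ x y, |f x - f y| ≤ K * dist x y) : ‖f‖ ≤ K :=
  csInf_le (lipBounds_bddBelow _) ⟨hK, h⟩

theorem lip0_abs_sub_le {e : X} (f : Lip0 e) (x y : X) : |f x - f y| ≤ ‖f‖ * dist x y := by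
  rcases eq_or_ne x y with rfl | hxy
  · simp
  · have hd : 0 < dist x y := dist_pos.mpr hxy
    rw [← div_le_iff₀ hd]
    refine le_csInf (lipBounds_nonempty f) fun K hK => ?_
    rw [div_le_iff₀ hd]
    exact hK.2 x y

theorem lip0_norm_smul_le {e : X} (c : ℝ) (f : Lip0 e) : ‖c • f‖ ≤ ‖c‖ * ‖f‖ := by
  refine lip0_norm_le _ (mul_nonneg (norm_nonneg c) (lip0_norm_nonneg f)) fun x y => ?_
  rw [lip0_smul_apply, lip0_smul_apply, ← mul_sub, abs_mul, Real.norm_eq_abs, mul_assoc]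
  exact mul_le_mul_of_nonneg_left (lip0_abs_sub_le f x y) (abs_nonneg c)

theorem lip0_core (e : X) : NormedSpace.Core ℝ (Lip0 e) where
  norm_nonneg := lip0_norm_nonneg
  norm_smul c f := by
    refine le_antisymm (lip0_norm_smul_le c f) ?_
    rcases eq_or_ne c 0 with rfl | hc
    · simpa using lip0_norm_nonneg ((0 : ℝ) • f)
    · have h := lip0_norm_smul_le c⁻¹ (c • f)
      rw [inv_smul_smul₀ hc, norm_inv] at h
      have hc' : 0 < ‖c‖ := norm_pos_iff.mpr hc
      rwa [inv_mul_eq_div, le_div_iff₀ hc', mul_comm] at h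
  norm_triangle f g := by
    refine lip0_norm_le _ (add_nonneg (lip0_norm_nonneg f) (lip0_norm_nonneg g)) fun x y => ?_
    rw [lip0_add_apply, lip0_add_apply, add_sub_add_comm, add_mul]
    exact (abs_add_le _ _).trans (add_le_add (lip0_abs_sub_le f x y) (lip0_abs_sub_le g x y))
  norm_eq_zero_iff f := by
    constructor
    · intro h
      refine lip0_ext fun x => ?_
      have hx := lip0_abs_sub_le f x e
      rw [h, zero_mul, lip0_base, sub_zero] at hx
      rw [lip0_zero_apply]
      exact abs_eq_zero.mp (le_antisymm hx (abs_nonneg _))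
    · rintro rfl
      exact le_antisymm (lip0_norm_le _ le_rfl fun x y => by simp [lip0_zero_apply])
        (lip0_norm_nonneg _)

instance (e : X) : NormedAddCommGroup (Lip0 e) := NormedAddCommGroup.ofCore (lip0_core e)

instance (e : X) : NormedSpace ℝ (Lip0 e) := NormedSpace.ofCore (lip0_core e)

/-- The evaluation functional `j(x) : f ↦ f(x)` in the dual of `Lip₀(X)`. -/
def evalDual (e x : X) : StrongDual ℝ (Lip0 e) :=
  LinearMap.mkContinuous
    { toFun := fun f => f x
      map_add' := fun f g => lip0_add_apply f g x
      map_smul' := fun c f => lip0_smul_apply c f x }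
    (dist x e)
    (fun f => by
      have h := lip0_abs_sub_le f x e
      rw [lip0_base, sub_zero, mul_comm] at h
      exact h)

/-- The Lipschitz-free space over the pointed space `(X, e)`: the closed linear span of the
evaluation functionals in the dual of `Lip₀(X)`, with the dual norm. -/
def lipschitzFree (e : X) : Submodule ℝ (StrongDual ℝ (Lip0 e)) :=
  (Submodule.span ℝ (Set.range (evalDual e))).topologicalClosure

/-- The canonical map `j` from `X` to its Lipschitz-free space. -/
def freeEmbedding (e x : X) : lipschitzFree e :=
  ⟨evalDual e x,
    Submodule.le_topologicalClosure _ (Submodule.subset_span (Set.mem_range_self x))⟩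

/-- The element `u_{pq} = (j(p) - j(q)) / ‖j(p) - j(q)‖` of the Lipschitz-free space. -/
def molecule (e p q : X) : lipschitzFree e :=
  ‖freeEmbedding e p - freeEmbedding e q‖⁻¹ • (freeEmbedding e p - freeEmbedding e q)

/-- The pointed metric space `(X, e)` is concave if `u_{pq}` is a preserved extreme point of the
unit ball of the Lipschitz-free space for all distinct `p`, `q`. -/
def IsConcave (e : X) : Prop :=
  ∀ p q : X, p ≠ q → IsPreservedExtremePoint (molecule e p q)

end Lip

end

end LipFree

/-! If `r` lies strictly between `p` and `q`, then `u_{pq}` is a proper convex combination of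
`u_{pr}` and `u_{rq}`, so it is not extreme.

Conversely, the dual of the free space is `Lip0 e`, so the bidual acts on Lipschitz functions. If
the slope functional at `(p, q)` is `a φ + b ψ` with `φ`, `ψ` in the dual ball, then `φ` and `ψ`
both take the value 1 at every norm-one `g` with slope 1 at `(p, q)`. When no third point lies
between `p` and `q`, compactness gives such a `g` whose slopes stay away from 1 at all pairs meeting
a given compact set that misses `p` and `q` (`exists_peaksAt_flatOn`). Perturbing this `g` shows
that `φ` only sees slopes near `(p, q)`, near `(p, p)` and near `(q, q)` (`apply_le_of_slope_le`).
Take `P` constant near `p` and near `q`, with slope 1 at `(p, q)`. Then `φ (P + k) = 1` whenever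
`‖k‖ ≤ 1` and `k p = k q`. Hence `φ` kills every `k` with `k p = k q`, so it is a multiple of the
slope functional, and `φ P = 1` makes the factor 1. -/

namespace LipFree

/-! ### Functions peaking at `(p, q)` and flat elsewhere -/

section Peak

variable {X : Type*} [MetricSpace X]

/-- `g` is `1`-Lipschitz and its slope at `(p, q)` is one. -/
def PeaksAt (g : X → ℝ) (p q : X) : Prop :=
  (∀ x y, g x - g y ≤ dist x y) ∧ g p - g q = dist p q

theorem PeaksAt.neg_swap {g : X → ℝ} {p q : X} (h : PeaksAt g p q) :
    PeaksAt (fun x => -g x) q p := by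
  refine ⟨fun x y => ?_, ?_⟩
  · have := h.1 y x
    rw [dist_comm] at this
    linarith
  · have := h.2
    rw [dist_comm] at this
    linarith

theorem PeaksAt.average {g h : X → ℝ} {p q : X} (hg : PeaksAt g p q) (hh : PeaksAt h p q) :
    PeaksAt (fun x => (g x + h x) / 2) p q := by
  refine ⟨fun x y => ?_, ?_⟩
  · have h₁ := hg.1 x y
    have h₂ := hh.1 x y
    linarith
  · have h₁ := hg.2
    have h₂ := hh.2
    linarith

theorem peaksAt_dist (p q : X) : PeaksAt (fun x => dist x q) p q :=
  ⟨fun x y => by linarith [dist_triangle x y q], by simp⟩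

/-- The slopes of `g` at all pairs that start or end in `S` are bounded away from one. -/
def FlatOn (g : X → ℝ) (S : Set X) : Prop :=
  ∃ δ : ℝ, 0 < δ ∧ δ ≤ 1 ∧ ∀ z ∈ S, ∀ y,
    g z - g y ≤ (1 - δ) * dist z y ∧ g y - g z ≤ (1 - δ) * dist z y

/-- The distance to `q` is cut off near `x` at a level below `dist x q`. The strict triangle
inequality leaves room for a cut that does not change the value at `p`. -/
theorem exists_peaksAt_source_flat [CompactSpace X] {p q x : X}
    (hx : dist p q < dist p x + dist x q) (hxq : x ≠ q) :
    ∃ g : X → ℝ, PeaksAt g p q ∧ ∃ r > 0, ∃ δ : ℝ, 0 < δ ∧ δ ≤ 1 ∧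
      ∀ z ∈ Metric.ball x r, ∀ y, g z - g y ≤ (1 - δ) * dist z y := by
  obtain ⟨D, hD⟩ := (Metric.isBounded_iff (s := (Set.univ : Set X))).1 isCompact_univ.isBounded
  have hD' : ∀ a b : X, dist a b ≤ D := fun a b => hD (Set.mem_univ a) (Set.mem_univ b)
  have hxq' : 0 < dist x q := dist_pos.2 hxq
  have hmlt : max 0 (dist p q - dist p x) < dist x q := max_lt hxq' (by linarith)
  set m := max 0 (dist p q - dist p x) with hm
  have hm0 : 0 ≤ m := le_max_left _ _
  have hm1 : dist p q - dist p x ≤ m := le_max_right _ _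
  obtain ⟨r, hr⟩ : ∃ r, r = (dist x q - m) / 4 := ⟨_, rfl⟩
  have hr0 : 0 < r := by rw [hr]; linarith
  have hDr : r < D := by linarith [hD' x q]
  have hDpos : 0 < D := hr0.trans hDr
  -- On the ball the cut lowers `dist z q` by at least `2 * r`. Slopes starting there lose at least
  -- `r` in absolute terms, and dividing by the diameter bound `D` makes the loss proportional.
  refine ⟨fun z => min (dist z q) (m + r + max 0 (dist z x - r)), ⟨fun a b => ?_, ?_⟩,
    r, hr0, r / D, div_pos hr0 hDpos, (div_le_one hDpos).2 hDr.le, fun z hz y => ?_⟩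
  · have h₁ := dist_triangle a b q
    have h₂ := dist_triangle a b x
    have h₃ : (0 : ℝ) ≤ dist a b := dist_nonneg
    have : max 0 (dist a x - r) ≤ dist a b + max 0 (dist b x - r) :=
      max_le (add_nonneg h₃ (le_max_left _ _)) (by linarith [le_max_right 0 (dist b x - r)])
    rcases min_choice (dist b q) (m + r + max 0 (dist b x - r)) with h | h <;> simp only [h]
    · linarith [min_le_left (dist a q) (m + r + max 0 (dist a x - r))]
    · linarith [min_le_right (dist a q) (m + r + max 0 (dist a x - r))]
  · have h₁ : min (dist p q) (m + r + max 0 (dist p x - r)) = dist p q :=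
      min_eq_left (by linarith [le_max_right 0 (dist p x - r)])
    have h₂ : min (dist q q) (m + r + max 0 (dist q x - r)) = 0 := by
      rw [dist_self]
      exact min_eq_left (by linarith [le_max_left 0 (dist q x - r)])
    simp only [h₁, h₂, sub_zero]
  · have hz' : dist z x < r := hz
    have hzq : dist x q ≤ dist z x + dist z q := by
      rw [dist_comm z x]; exact dist_triangle x z q
    have hgz : min (dist z q) (m + r + max 0 (dist z x - r)) ≤ m + r := by
      refine (min_le_right _ _).trans ?_
      rw [max_eq_left (by linarith)]; linarith
    have hδ : (r / D) * dist z y ≤ r := by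
      rw [div_mul_eq_mul_div, div_le_iff₀ hDpos]
      exact mul_le_mul_of_nonneg_left (hD' z y) hr0.le
    have hδ' : (r / D) * dist z y ≤ dist z y :=
      mul_le_of_le_one_left dist_nonneg ((div_le_one hDpos).2 hDr.le)
    rw [sub_mul, one_mul]
    rcases min_choice (dist y q) (m + r + max 0 (dist y x - r)) with h | h <;> simp only [h]
    · linarith [dist_triangle z y q]
    · linarith [le_max_left 0 (dist y x - r)]

theorem FlatOn.average {g h : X → ℝ} {p q : X} {S T : Set X} (hg : PeaksAt g p q)
    (hh : PeaksAt h p q) (hS : FlatOn g S) (hT : FlatOn h T) :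
    FlatOn (fun x => (g x + h x) / 2) (S ∪ T) := by
  obtain ⟨δ, hδ, hδ', hgS⟩ := hS
  obtain ⟨ε, hε, hε', hhT⟩ := hT
  refine ⟨min δ ε / 2, by positivity, by linarith [min_le_left δ ε], fun z hz y => ?_⟩
  have hd : (0 : ℝ) ≤ dist z y := dist_nonneg
  have h₁ := mul_le_mul_of_nonneg_right (min_le_left δ ε) hd
  have h₂ := mul_le_mul_of_nonneg_right (min_le_right δ ε) hd
  have g₁ := hg.1 z y
  have g₂ := hg.1 y z
  have h₃ := hh.1 z y
  have h₄ := hh.1 y z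
  rw [dist_comm y z] at g₂ h₄
  rcases hz with hz | hz
  · obtain ⟨a, b⟩ := hgS z hz y
    constructor <;> linarith
  · obtain ⟨a, b⟩ := hhT z hz y
    constructor <;> linarith

/-- The cut-off controls only slopes starting in the ball. Exchanging `p` and `q` and negating
controls those ending there, and the average has both properties with half the gap. -/
theorem exists_peaksAt_flatOn_ball [CompactSpace X] {p q x : X}
    (hx : dist p q < dist p x + dist x q) (hxp : x ≠ p) (hxq : x ≠ q) :
    ∃ g : X → ℝ, PeaksAt g p q ∧ ∃ r > 0, FlatOn g (Metric.ball x r) := by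
  obtain ⟨g, hg, r, hr, δ, hδ, hδ', hgr⟩ := exists_peaksAt_source_flat hx hxq
  obtain ⟨h, hh, s, hs, ε, hε, hε', hhs⟩ := exists_peaksAt_source_flat (p := q) (q := p) (x := x)
    (by rw [dist_comm q p, dist_comm q x, dist_comm x p]; linarith) hxp
  refine ⟨_, hg.average hh.neg_swap, min r s, lt_min hr hs, min δ ε / 2, by positivity,
    by linarith [min_le_left δ ε], fun z hz y => ?_⟩
  have hd : (0 : ℝ) ≤ dist z y := dist_nonneg
  have h₁ := mul_le_mul_of_nonneg_right (min_le_left δ ε) hd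
  have h₂ := mul_le_mul_of_nonneg_right (min_le_right δ ε) hd
  have a := hgr z (Metric.ball_subset_ball (min_le_left r s) hz) y
  have b := hhs z (Metric.ball_subset_ball (min_le_right r s) hz) y
  have g₂ := hg.1 y z
  have h₄ := hh.1 y z
  rw [dist_comm y z] at g₂ h₄
  constructor <;> linarith

theorem exists_peaksAt_flatOn [CompactSpace X] {p q : X}
    (hpq : ∀ x, x ≠ p → x ≠ q → dist p q < dist p x + dist x q) {K : Set X} (hK : IsCompact K)
    (hp : p ∉ K) (hq : q ∉ K) : ∃ g : X → ℝ, PeaksAt g p q ∧ FlatOn g K := by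
  refine hK.induction_on (p := fun S => ∃ g : X → ℝ, PeaksAt g p q ∧ FlatOn g S)
    ⟨_, peaksAt_dist p q, 1, one_pos, le_rfl, fun z hz => hz.elim⟩ ?_ ?_ ?_
  · rintro S T hST ⟨g, hg, δ, hδ, hδ', h⟩
    exact ⟨g, hg, δ, hδ, hδ', fun z hz => h z (hST hz)⟩
  · rintro S T ⟨g, hg, hS⟩ ⟨h, hh, hT⟩
    exact ⟨_, hg.average hh, hS.average hg hh hT⟩
  · intro x hx
    have hxp : x ≠ p := fun h => hp (h ▸ hx)
    have hxq : x ≠ q := fun h => hq (h ▸ hx)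
    obtain ⟨g, hg, r, hr, hf⟩ := exists_peaksAt_flatOn_ball (hpq x hxp hxq) hxp hxq
    exact ⟨_, mem_nhdsWithin_of_mem_nhds (Metric.ball_mem_nhds x hr), g, hg, hf⟩

end Peak

/-! ### Functionals on `Lip0 e` that are 1 at all peaking functions -/

section Functional

variable {X : Type*} [MetricSpace X]

theorem abs_sub_le_of_sub_le {g : X → ℝ} {K : ℝ} (h : ∀ x y, g x - g y ≤ K * dist x y) (x y : X) :
    |g x - g y| ≤ K * dist x y := by
  have := h y x
  rw [dist_comm] at this
  exact abs_le.2 ⟨by linarith, h x y⟩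

/-- The function `g - g e` as an element of `Lip₀(X)`. -/
noncomputable def lip0Of (e : X) (g : X → ℝ) (K : ℝ) (hK : 0 ≤ K)
    (h : ∀ x y, g x - g y ≤ K * dist x y) : Lip0 e :=
  ⟨fun x => g x - g e, ⟨⟨K, hK⟩, LipschitzWith.of_dist_le_mul fun x y => by
    rw [Real.dist_eq, sub_sub_sub_cancel_right]
    exact abs_sub_le_of_sub_le h x y⟩, sub_self _⟩

theorem lip0Of_sub (e : X) (g : X → ℝ) (K : ℝ) (hK : 0 ≤ K)
    (h : ∀ x y, g x - g y ≤ K * dist x y) (x y : X) :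
    lip0Of e g K hK h x - lip0Of e g K hK h y = g x - g y :=
  sub_sub_sub_cancel_right _ _ _

theorem lip0Of_norm_le (e : X) (g : X → ℝ) (K : ℝ) (hK : 0 ≤ K)
    (h : ∀ x y, g x - g y ≤ K * dist x y) : ‖lip0Of e g K hK h‖ ≤ K :=
  lip0_norm_le _ hK fun x y => by
    rw [lip0Of_sub]
    exact abs_sub_le_of_sub_le h x y

theorem lip0_sub_le {e : X} (f : Lip0 e) (x y : X) : f x - f y ≤ ‖f‖ * dist x y :=
  (le_abs_self _).trans (lip0_abs_sub_le f x y)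

/-- A functional of norm at most one that takes the value one at `g` only sees the slopes of a
function at the pairs where the slope of `g` is close to one. -/
theorem apply_le_of_slope_le {e : X} (φ : Lip0 e →ₗ[ℝ] ℝ) (hφ : ∀ f, φ f ≤ ‖f‖) {g : Lip0 e}
    (hg : ∀ x y, g x - g y ≤ dist x y) (hφg : φ g = 1) {F : Lip0 e} {C δ : ℝ} (hC : 0 ≤ C)
    (hδ : 0 < δ) (h : ∀ x y, g x - g y ≤ (1 - δ) * dist x y ∨ F x - F y ≤ C * dist x y) :
    φ F ≤ C := by
  have hF := lip0_norm_nonneg F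
  -- So small a `t` that adding `t • F` cannot lift a slope of at most `1 - δ` above 1. Then `1 + t
  -- * φ F ≤ ‖g + t • F‖ ≤ 1 + t * C`.
  obtain ⟨t, ht⟩ : ∃ t, t = δ / (‖F‖ + 1) := ⟨_, rfl⟩
  have ht0 : 0 < t := by rw [ht]; positivity
  have htF : t * ‖F‖ ≤ δ := by
    rw [ht, div_mul_eq_mul_div, div_le_iff₀ (by positivity)]
    nlinarith
  have hnorm : ‖g + t • F‖ ≤ 1 + t * C := by
    refine lip0_norm_le _ (by positivity) (abs_sub_le_of_sub_le fun x y => ?_)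
    have hd : (0 : ℝ) ≤ dist x y := dist_nonneg
    simp only [lip0_add_apply, lip0_smul_apply]
    rcases h x y with h | h
    · have h₁ := mul_le_mul_of_nonneg_left (lip0_sub_le F x y) ht0.le
      have h₂ := mul_le_mul_of_nonneg_right htF hd
      have h₃ : 0 ≤ t * C * dist x y := by positivity
      linarith
    · have h₁ := mul_le_mul_of_nonneg_left h ht0.le
      linarith [hg x y]
  have := (hφ _).trans hnorm
  rw [map_add, map_smul, hφg, smul_eq_mul] at this
  exact le_of_mul_le_mul_left (by linarith) ht0

/-- A Lipschitz function that is locally constant at `p` and at `q`. -/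
noncomputable def plateau (p q : X) (z : X) : ℝ :=
  min (dist p q) (3 * max 0 (dist z q - dist p q / 3))

theorem plateau_sub_le (p q x y : X) : plateau p q x - plateau p q y ≤ 3 * dist x y := by
  have h₁ := dist_triangle x y q
  have h₃ : (0 : ℝ) ≤ dist x y := dist_nonneg
  have h₂ : max 0 (dist x q - dist p q / 3) ≤ dist x y + max 0 (dist y q - dist p q / 3) :=
    max_le (add_nonneg h₃ (le_max_left _ _))
      (by linarith [le_max_right 0 (dist y q - dist p q / 3)])
  unfold plateau
  rcases min_choice (dist p q) (3 * max 0 (dist y q - dist p q / 3)) with h | h <;> rw [h]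
  · linarith [min_le_left (dist p q) (3 * max 0 (dist x q - dist p q / 3))]
  · linarith [min_le_right (dist p q) (3 * max 0 (dist x q - dist p q / 3))]

/-- Such a `z` is at least two thirds of `dist p q` away from `q`, which is where the ramp of slope
3 reaches its cap. -/
theorem plateau_left {p q z : X} (h : dist z p ≤ dist p q / 3) : plateau p q z = dist p q := by
  have := dist_triangle_left p q z
  exact min_eq_left (by linarith [le_max_right 0 (dist z q - dist p q / 3)])

theorem plateau_right {p q z : X} (h : dist z q ≤ dist p q / 3) : plateau p q z = 0 := by
  unfold plateau
  rw [max_eq_left (by linarith), mul_zero, min_eq_right dist_nonneg]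

variable [CompactSpace X] {e p q : X}

theorem apply_plateau_add_le (hne : p ≠ q)
    (hpq : ∀ x, x ≠ p → x ≠ q → dist p q < dist p x + dist x q)
    (φ : Lip0 e →ₗ[ℝ] ℝ) (hφ : ∀ f, φ f ≤ ‖f‖)
    (hpeak : ∀ g : Lip0 e, ‖g‖ ≤ 1 → g p - g q = dist p q → φ g = 1)
    {F k : Lip0 e} (hk : ‖k‖ ≤ 1) (hkpq : k p = k q)
    (hF : ∀ x y, F x - F y = plateau p q x - plateau p q y + (k x - k y)) : φ F ≤ 1 := by
  have hd : 0 < dist p q := dist_pos.2 hne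
  have hkl : ∀ x y, k x - k y ≤ dist x y := fun x y =>
    (lip0_sub_le k x y).trans (mul_le_of_le_one_left dist_nonneg hk)
  suffices H : ∀ η : ℝ, 0 < η → η ≤ 1 → φ F ≤ 1 + η by
    refine le_of_forall_pos_le_add fun η hη => ?_
    exact (H (min η 1) (by positivity) (min_le_right _ _)).trans (by linarith [min_le_left η 1])
  intro η hη hη1
  -- Chosen so that `dist p q + 2 * ε ≤ (1 + η) * (dist p q - 2 * ε)`, which bounds the slope from
  -- near `p` to near `q`.
  obtain ⟨ε, hε⟩ : ∃ ε, ε = η * dist p q / 6 := ⟨_, rfl⟩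
  have hε0 : 0 < ε := by rw [hε]; positivity
  have hε3 : ε ≤ dist p q / 6 := by
    rw [hε]; linarith [mul_le_of_le_one_left hd.le hη1]
  obtain ⟨g, hg, δ, hδ, hδ1, hflat⟩ := exists_peaksAt_flatOn hpq
    (K := (Metric.ball p ε ∪ Metric.ball q ε)ᶜ)
    (Metric.isOpen_ball.union Metric.isOpen_ball).isClosed_compl.isCompact
    (fun h => h (Or.inl (Metric.mem_ball_self hε0))) (fun h => h (Or.inr (Metric.mem_ball_self hε0)))
  have hgl : ∀ x y, g x - g y ≤ 1 * dist x y := fun x y => by simpa using hg.1 x y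
  refine apply_le_of_slope_le φ hφ (g := lip0Of e g 1 zero_le_one hgl) (C := 1 + η) (δ := δ)
    (fun x y => by rw [lip0Of_sub]; exact hg.1 x y)
    (hpeak _ (lip0Of_norm_le ..) (by rw [lip0Of_sub]; exact hg.2)) (by linarith) hδ fun x y => ?_
  rw [lip0Of_sub, hF]
  have hdxy : (0 : ℝ) ≤ dist x y := dist_nonneg
  have hηd : 0 ≤ η * dist x y := by positivity
  by_cases hx : x ∈ Metric.ball p ε ∪ Metric.ball q ε
  swap
  · exact Or.inl (hflat x hx y).1
  by_cases hy : y ∈ Metric.ball p ε ∪ Metric.ball q ε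
  swap
  · left
    have := (hflat y hy x).2
    rwa [dist_comm] at this
  have hkxy := hkl x y
  rcases hx with hx | hx <;> rcases hy with hy | hy <;> rw [Metric.mem_ball] at hx hy
  · right
    rw [plateau_left (by linarith), plateau_left (by linarith)]
    linarith
  · right
    rw [plateau_left (by linarith), plateau_right (by linarith)]
    have h₁ := hkl x p
    have h₂ := hkl q y
    have h₃ : dist p q ≤ dist x p + dist x y + dist y q := by
      have := dist_triangle4 p x y q
      rwa [dist_comm p x] at this
    rw [dist_comm q y] at h₂
    have h₄ : dist p q - 2 * ε ≤ dist x y := by linarith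
    have h₅ := mul_le_mul_of_nonneg_left h₄ (by linarith : 0 ≤ 1 + η)
    have h₆ : η * ε ≤ ε := mul_le_of_le_one_left hε0.le hη1
    linarith
  -- From near `q` to near `p` the function `g` does not increase.
  · left
    have h₁ := hg.1 x q
    have h₂ := hg.1 p y
    have h₃ := hg.2
    rw [dist_comm p y] at h₂
    have : 0 ≤ (1 - δ) * dist x y := mul_nonneg (by linarith) hdxy
    linarith
  · right
    rw [plateau_right (by linarith), plateau_right (by linarith)]
    linarith

/-- The normalised evaluation difference at `(p, q)` is an extreme point of the unit ball of
the dual of `Lip₀(X)`, if no third point lies between `p` and `q`. -/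
theorem apply_eq_slope_of_convex_combination (hne : p ≠ q)
    (hpq : ∀ x, x ≠ p → x ≠ q → dist p q < dist p x + dist x q)
    (φ ψ : Lip0 e →ₗ[ℝ] ℝ) (hφ : ∀ f, φ f ≤ ‖f‖) (hψ : ∀ f, ψ f ≤ ‖f‖)
    {a b : ℝ} (ha : 0 < a) (hb : 0 < b) (hab : a + b = 1)
    (h : ∀ f : Lip0 e, a * φ f + b * ψ f = (dist p q)⁻¹ * (f p - f q)) (f : Lip0 e) :
    φ f = (dist p q)⁻¹ * (f p - f q) := by
  have hd : 0 < dist p q := dist_pos.2 hne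
  have heq : ∀ {s t : ℝ}, s ≤ 1 → t ≤ 1 → a * s + b * t = 1 → s = 1 ∧ t = 1 := by
    intro s t hs ht hst
    have h₁ := mul_le_mul_of_nonneg_left hs ha.le
    have h₂ := mul_le_mul_of_nonneg_left ht hb.le
    exact ⟨mul_left_cancel₀ ha.ne' (by linarith), mul_left_cancel₀ hb.ne' (by linarith)⟩
  have hpeak : ∀ g : Lip0 e, ‖g‖ ≤ 1 → g p - g q = dist p q → φ g = 1 ∧ ψ g = 1 := by
    intro g hg hgpq
    refine heq ((hφ g).trans hg) ((hψ g).trans hg) ?_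
    rw [h, hgpq, inv_mul_cancel₀ hd.ne']
  obtain ⟨P, hP⟩ : ∃ P : Lip0 e, ∀ x y, P x - P y = plateau p q x - plateau p q y :=
    ⟨lip0Of e (plateau p q) 3 (by norm_num) (plateau_sub_le p q), fun x y => lip0Of_sub _ _ _ _ _ x y⟩
  have hPpq : P p - P q = dist p q := by
    rw [hP, plateau_left (by rw [dist_self]; positivity),
      plateau_right (by rw [dist_self]; positivity), sub_zero]
  have hadd : ∀ k : Lip0 e, ‖k‖ ≤ 1 → k p = k q → φ (P + k) = 1 := by
    intro k hk hkpq
    have hs : ∀ x y, (P + k) x - (P + k) y = plateau p q x - plateau p q y + (k x - k y) := by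
      intro x y
      rw [lip0_add_apply, lip0_add_apply, ← hP]
      ring
    refine (heq
      (apply_plateau_add_le hne hpq φ hφ (fun g hg hgpq => (hpeak g hg hgpq).1) hk hkpq hs)
      (apply_plateau_add_le hne hpq ψ hψ (fun g hg hgpq => (hpeak g hg hgpq).2) hk hkpq hs) ?_).1
    rw [h, lip0_add_apply, lip0_add_apply, hkpq, add_sub_add_right_eq_sub, hPpq,
      inv_mul_cancel₀ hd.ne']
  have hφP : φ P = 1 := by
    simpa using hadd 0 (by simp) rfl
  have hzero : ∀ k : Lip0 e, k p = k q → φ k = 0 := by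
    intro k hkpq
    have hn : 0 < ‖k‖ + 1 := by positivity
    have h₁ := hadd ((‖k‖ + 1)⁻¹ • k) (by
      rw [norm_smul, norm_inv, Real.norm_of_nonneg hn.le, inv_mul_le_one₀ hn]
      linarith) (by rw [lip0_smul_apply, lip0_smul_apply, hkpq])
    rw [map_add, hφP, map_smul, smul_eq_mul, add_eq_left] at h₁
    exact (mul_eq_zero.1 h₁).resolve_left (inv_ne_zero hn.ne')
  obtain ⟨c, hc⟩ : ∃ c, c = (dist p q)⁻¹ * (f p - f q) := ⟨_, rfl⟩
  have hcd : c * dist p q = f p - f q := by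
    rw [hc]; field_simp
  -- Subtracting `c • P` makes the values at `p` and `q` equal.
  have h₁ := hzero (f + (-c) • P) (by
    rw [lip0_add_apply, lip0_add_apply, lip0_smul_apply, lip0_smul_apply]
    rw [← hPpq] at hcd
    linarith)
  rw [map_add, map_smul, hφP, smul_eq_mul] at h₁
  rw [← hc]
  linarith

end Functional

/-! ### Reduction to the bidual ball -/

section Bidual

theorem norm_inclusionInDoubleDual_le {Y : Type*} [NormedAddCommGroup Y] [NormedSpace ℝ Y]
    (y : Y) : ‖NormedSpace.inclusionInDoubleDual ℝ Y y‖ ≤ ‖y‖ :=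
  NormedSpace.double_dual_bound ℝ Y y

theorem mem_bidual_closedBall {Y : Type*} [NormedAddCommGroup Y] [NormedSpace ℝ Y]
    {Φ : StrongDual ℝ (StrongDual ℝ Y)} :
    Φ ∈ Metric.closedBall (0 : StrongDual ℝ (StrongDual ℝ Y)) 1 ↔ ‖Φ‖ ≤ 1 :=
  mem_closedBall_zero_iff (E := StrongDual ℝ (StrongDual ℝ Y))

/-- The canonical embedding is a linear isometry, so a convex decomposition in `Y` is also one in
the bidual. -/
theorem isPreservedExtremePoint_of_bidual {Y : Type*} [NormedAddCommGroup Y] [NormedSpace ℝ Y]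
    {y : Y} (hy : ‖y‖ ≤ 1)
    (h : ∀ Φ Ψ : StrongDual ℝ (StrongDual ℝ Y), ‖Φ‖ ≤ 1 → ‖Ψ‖ ≤ 1 → ∀ a b : ℝ, 0 < a → 0 < b →
      a + b = 1 → a • Φ + b • Ψ = NormedSpace.inclusionInDoubleDual ℝ Y y →
      Φ = NormedSpace.inclusionInDoubleDual ℝ Y y) :
    IsPreservedExtremePoint y := by
  refine ⟨⟨mem_closedBall_zero_iff.2 hy, ?_⟩, ⟨mem_bidual_closedBall.2
    ((norm_inclusionInDoubleDual_le y).trans hy), ?_⟩⟩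
  · rintro u hu v hv ⟨a, b, ha, hb, hab, huv⟩
    rw [mem_closedBall_zero_iff] at hu hv
    have := h _ _ ((norm_inclusionInDoubleDual_le u).trans hu)
      ((norm_inclusionInDoubleDual_le v).trans hv) a b ha hb hab
      (by rw [← map_smul, ← map_smul, ← map_add, huv])
    exact (NormedSpace.inclusionInDoubleDualLi ℝ (E := Y)).injective this
  · rintro Φ hΦ Ψ hΨ ⟨a, b, ha, hb, hab, hΦΨ⟩
    exact h Φ Ψ (mem_bidual_closedBall.1 hΦ) (mem_bidual_closedBall.1 hΨ) a b
      ha hb hab hΦΨ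

end Bidual

/-! ### Duality for the Lipschitz-free space and both implications -/

section Free

variable {X : Type*} [MetricSpace X]

/-- A normed space `Y` with a map `j` from `X` to `Y` and a pairing `B` with `Lip₀(X)` that make
it a Lipschitz-free space over `(X, e)`. -/
structure IsFreeModel (e : X) {Y : Type*} [NormedAddCommGroup Y] [NormedSpace ℝ Y] (j : X → Y)
    (B : Lip0 e → Y → ℝ) : Prop where
  map_base : j e = 0
  dense_span : ∀ m : Y, m ∈ closure (Submodule.span ℝ (Set.range j) : Set Y)
  add_left : ∀ f g m, B (f + g) m = B f m + B g m
  smul_left : ∀ (c : ℝ) f m, B (c • f) m = c * B f m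
  add_right : ∀ f m n, B f (m + n) = B f m + B f n
  smul_right : ∀ (c : ℝ) f m, B f (c • m) = c * B f m
  abs_le : ∀ f m, |B f m| ≤ ‖f‖ * ‖m‖
  norm_sub_le : ∀ x y, ‖j x - j y‖ ≤ dist x y
  apply_map : ∀ f x, B f (j x) = f x

namespace IsFreeModel

variable {e : X} {Y : Type*} [NormedAddCommGroup Y] [NormedSpace ℝ Y] {j : X → Y}
  {B : Lip0 e → Y → ℝ}

theorem apply_sub (h : IsFreeModel e j B) (f : Lip0 e) (x y : X) :
    B f (j x - j y) = f x - f y := by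
  rw [sub_eq_add_neg, ← neg_one_smul ℝ (j y), h.add_right, h.smul_right, h.apply_map, h.apply_map]
  ring

theorem norm_sub (h : IsFreeModel e j B) (p q : X) : ‖j p - j q‖ = dist p q := by
  refine le_antisymm (h.norm_sub_le p q) ?_
  have hl : ∀ x y : X, dist x q - dist y q ≤ 1 * dist x y := fun x y => by
    linarith [dist_triangle x y q]
  have h₁ := h.abs_le (lip0Of e _ 1 zero_le_one hl) (j p - j q)
  rw [h.apply_sub, lip0Of_sub, dist_self, sub_zero, abs_of_nonneg dist_nonneg] at h₁
  exact h₁.trans (mul_le_of_le_one_left (norm_nonneg _) (lip0Of_norm_le ..))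

theorem apply_molecule (h : IsFreeModel e j B) (f : Lip0 e) (p q : X) :
    B f (‖j p - j q‖⁻¹ • (j p - j q)) = (dist p q)⁻¹ * (f p - f q) := by
  rw [h.smul_right, h.apply_sub, h.norm_sub]

theorem norm_molecule (h : IsFreeModel e j B) {p q : X} (hpq : p ≠ q) :
    ‖‖j p - j q‖⁻¹ • (j p - j q)‖ = 1 := by
  rw [norm_smul, norm_inv, norm_norm, h.norm_sub, inv_mul_cancel₀ (dist_pos.2 hpq).ne']

/-- A Lipschitz function as a functional on the Lipschitz-free space. -/
noncomputable def toDual (h : IsFreeModel e j B) (f : Lip0 e) : StrongDual ℝ Y :=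
  LinearMap.mkContinuous
    { toFun := B f
      map_add' := h.add_right f
      map_smul' := fun c m => h.smul_right c f m } ‖f‖ (h.abs_le f)

theorem toDual_apply (h : IsFreeModel e j B) (f : Lip0 e) (m : Y) : h.toDual f m = B f m := rfl

theorem norm_toDual_le (h : IsFreeModel e j B) (f : Lip0 e) : ‖h.toDual f‖ ≤ ‖f‖ :=
  LinearMap.mkContinuous_norm_le _ (lip0_norm_nonneg f) _

/-- A functional `ℓ` is fixed by `ℓ ∘ j` on a dense span, and `ℓ ∘ j` is Lipschitz because `j` is
isometric. -/
theorem toDual_surjective (h : IsFreeModel e j B) : Function.Surjective h.toDual := by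
  intro ℓ
  have hl : ∀ x y : X, ℓ (j x) - ℓ (j y) ≤ ‖ℓ‖ * dist x y := by
    intro x y
    rw [← map_sub, ← h.norm_sub]
    exact (le_abs_self _).trans (ℓ.le_opNorm _)
  refine ⟨lip0Of e _ ‖ℓ‖ (norm_nonneg _) hl, ?_⟩
  refine ContinuousLinearMap.ext_on h.dense_span ?_
  rintro _ ⟨x, rfl⟩
  rw [toDual_apply, h.apply_map]
  change ℓ (j x) - ℓ (j e) = _
  rw [h.map_base, map_zero, sub_zero]

/-- The functional on `Lip₀(X)` induced by an element of the bidual of the Lipschitz-free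
space. -/
noncomputable def pullback (h : IsFreeModel e j B) (Φ : StrongDual ℝ (StrongDual ℝ Y)) :
    Lip0 e →ₗ[ℝ] ℝ where
  toFun f := Φ (h.toDual f)
  map_add' f g := by
    rw [← map_add]
    exact congrArg Φ (ContinuousLinearMap.ext fun m => h.add_left f g m)
  map_smul' c f := by
    rw [← map_smul]
    exact congrArg Φ (ContinuousLinearMap.ext fun m => h.smul_left c f m)

theorem pullback_le (h : IsFreeModel e j B) {Φ : StrongDual ℝ (StrongDual ℝ Y)} (hΦ : ‖Φ‖ ≤ 1)
    (f : Lip0 e) : h.pullback Φ f ≤ ‖f‖ :=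
  (le_abs_self _).trans ((Φ.le_opNorm _).trans
    ((mul_le_of_le_one_left (norm_nonneg _) hΦ).trans (h.norm_toDual_le f)))

theorem isPreservedExtremePoint_molecule [CompactSpace X] (h : IsFreeModel e j B) {p q : X}
    (hne : p ≠ q) (hpq : ∀ x, x ≠ p → x ≠ q → dist p q < dist p x + dist x q) :
    IsPreservedExtremePoint (‖j p - j q‖⁻¹ • (j p - j q)) := by
  refine isPreservedExtremePoint_of_bidual (h.norm_molecule hne).le
    fun Φ Ψ hΦ hΨ a b ha hb hab hcomb => ?_
  refine ContinuousLinearMap.ext fun ℓ => ?_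
  obtain ⟨f, rfl⟩ := h.toDual_surjective ℓ
  rw [NormedSpace.dual_def, toDual_apply, h.apply_molecule]
  refine apply_eq_slope_of_convex_combination hne hpq (h.pullback Φ) (h.pullback Ψ)
    (h.pullback_le hΦ) (h.pullback_le hΨ) ha hb hab (fun f => ?_) f
  rw [← h.apply_molecule]
  exact congrArg (fun Θ : StrongDual ℝ (StrongDual ℝ Y) => Θ (h.toDual f)) hcomb

theorem not_isPreservedExtremePoint_molecule (h : IsFreeModel e j B) {p q r : X}
    (hr : LiesStrictlyBetween r p q) :
    ¬ IsPreservedExtremePoint (‖j p - j q‖⁻¹ • (j p - j q)) := by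
  rintro ⟨⟨-, hext⟩, -⟩
  obtain ⟨hb, hrp, hrq⟩ := hr
  have hb' : dist p r + dist r q = dist p q := hb
  have h₁ : 0 < dist p r := dist_pos.2 hrp.symm
  have h₂ : 0 < dist r q := dist_pos.2 hrq
  have hd : 0 < dist p q := by linarith
  have heq : ‖j p - j r‖⁻¹ • (j p - j r) = ‖j p - j q‖⁻¹ • (j p - j q) := by
    refine hext (mem_closedBall_zero_iff.2 (h.norm_molecule hrp.symm).le)
      (mem_closedBall_zero_iff.2 (h.norm_molecule hrq).le)
      ⟨dist p r / dist p q, dist r q / dist p q, by positivity, by positivity, ?_, ?_⟩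
    · rw [← add_div, hb', div_self hd.ne']
    · rw [h.norm_sub, h.norm_sub, h.norm_sub, smul_smul, smul_smul, div_mul_eq_mul_div,
        div_mul_eq_mul_div, mul_inv_cancel₀ h₁.ne', mul_inv_cancel₀ h₂.ne', ← smul_add,
        sub_add_sub_cancel, one_div]
  -- This truncated distance separates the two: it gives `-1` at `u_{pr}` but `-(dist p r / dist p
  -- q)` at `u_{pq}`.
  have hl : ∀ x y : X, min (dist p r) (dist p x) - min (dist p r) (dist p y) ≤ 1 * dist x y := by
    intro x y
    have h₃ := dist_triangle p y x
    have h₄ : (0 : ℝ) ≤ dist x y := dist_nonneg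
    rw [dist_comm y x] at h₃
    rcases min_choice (dist p r) (dist p y) with h | h <;> rw [h]
    · linarith [min_le_left (dist p r) (dist p x)]
    · linarith [min_le_right (dist p r) (dist p x)]
  have := congrArg (B (lip0Of e _ 1 zero_le_one hl)) heq
  simp only [h.apply_molecule, lip0Of_sub, dist_self, min_self] at this
  rw [min_eq_right h₁.le, min_eq_left (by linarith), zero_sub, mul_neg, mul_neg, neg_inj,
    inv_mul_cancel₀ h₁.ne', eq_comm, inv_mul_eq_one₀ hd.ne'] at this
  linarith

end IsFreeModel

theorem mem_closure_span_freeEmbedding (e : X) (m : lipschitzFree e) :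
    m ∈ closure (Submodule.span ℝ (Set.range (freeEmbedding e)) : Set (lipschitzFree e)) := by
  rw [closure_subtype]
  refine closure_mono ?_ m.2
  intro y hy
  have hmap : (Submodule.span ℝ (Set.range (freeEmbedding e))).map (lipschitzFree e).subtype =
      Submodule.span ℝ (Set.range (evalDual e)) := by
    rw [Submodule.map_span, ← Set.range_comp]
    rfl
  rw [← hmap] at hy
  exact hy

theorem isFreeModel_lipschitzFree (e : X) :
    IsFreeModel e (freeEmbedding e) (fun f m => m.1 f) where
  map_base := Subtype.ext (ContinuousLinearMap.ext fun f => lip0_base f)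
  dense_span := mem_closure_span_freeEmbedding e
  add_left f g m := m.1.map_add f g
  smul_left c f m := m.1.map_smul c f
  add_right _ _ _ := rfl
  smul_right _ _ _ := rfl
  abs_le f m := (m.1.le_opNorm f).trans_eq (mul_comm _ _)
  norm_sub_le p q := ContinuousLinearMap.opNorm_le_bound _ dist_nonneg fun f =>
    (lip0_abs_sub_le f p q).trans_eq (mul_comm _ _)
  apply_map _ _ := rfl

end Free

end LipFree

theorem corollary4p4 {X : Type*} [MetricSpace X] [CompactSpace X] (e : X) :
    LipFree.IsConcave e ↔ ¬ ∃ p q r : X, LipFree.MetricallyAligned p q r := by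
  constructor
  · rintro h ⟨p, q, r, ⟨hpq, hqr, hpr⟩, hb | hb | hb⟩
    · exact (LipFree.isFreeModel_lipschitzFree e).not_isPreservedExtremePoint_molecule hb (h q r hqr)
    · exact (LipFree.isFreeModel_lipschitzFree e).not_isPreservedExtremePoint_molecule hb (h p r hpr)
    · exact (LipFree.isFreeModel_lipschitzFree e).not_isPreservedExtremePoint_molecule hb (h p q hpq)
  · intro h p q hpq
    refine (LipFree.isFreeModel_lipschitzFree e).isPreservedExtremePoint_molecule hpq fun x hxp hxq => ?_
    refine lt_of_le_of_ne (dist_triangle p x q) fun heq =>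
      h ⟨p, q, x, ⟨hpq, hxq.symm, hxp.symm⟩, ?_⟩
    exact Or.inr (Or.inr ⟨heq.symm, hxp, hxq⟩)
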